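/- Consider the endgame of king, bishop and knight (White) against a lone king (Black) on an $n\times n$ chessboard with $n$ even, under the usual rules of chess but without the 50-move rule. Number the files $0,1,\dots,n-1$ from left to right and the ranks $0,1,\dots,n-1$ from bottom to top, so that $(0,0)$ is a dark square. White has a light-squared bishop; thus the corner $(0,0)$ is "safe" for Black and the corner $(n-1,0)$ is a mating corner. For an even number $x$, let $P_x$ be the following position with Black to move: the black king is on $(x,0)$, the white knight on $(x,1)$, the white king on $(x,2)$ and the white bishop on $(x,5)$. (1) Let $n$ and $x$ be even with $4\le x\le n-4$. Starting from $P_x$, White can force, in at most $12$ white moves, that either the position $P_{x+2}$ occurs (the same relative position, shifted two files toward the mating corner, again with Black to move) or Black is already checkmated. (2) There is a constant $C$ such that for all even $n$ and all even $x$ with $4\le x\le n-2$, White can force checkmate from $P_x$ in at most $Cn$ moves. In other words, once Black is trapped in this way along the edge, checkmate follows in time linear in $n$. -/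

import Mathlib

/-- A square, given by (file, rank), both counted from `0`; so `(4, 0)` is e1. -/
abbrev Square := ℤ × ℤ

/-- The squares of the `n × n` board. -/
def OnBoard (n : ℕ) (s : Square) : Prop :=
  0 ≤ s.1 ∧ s.1 < n ∧ 0 ≤ s.2 ∧ s.2 < n

/-- `s` and `t` are one king's step apart. -/
def KingStep (s t : Square) : Prop :=
  s ≠ t ∧ |s.1 - t.1| ≤ 1 ∧ |s.2 - t.2| ≤ 1

/-- `s` and `t` are one knight's jump apart. -/
def KnightStep (s t : Square) : Prop :=
  (|s.1 - t.1| = 1 ∧ |s.2 - t.2| = 2) ∨ (|s.1 - t.1| = 2 ∧ |s.2 - t.2| = 1)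

/-- `t` is reached from `s` along a diagonal whose squares strictly in between
are not in the set `occ` of occupied squares. -/
def BishopStep (occ : Set Square) (s t : Square) : Prop :=
  ∃ dx dy : ℤ, (dx = 1 ∨ dx = -1) ∧ (dy = 1 ∨ dy = -1) ∧
    ∃ k : ℕ, 1 ≤ k ∧ t = (s.1 + k * dx, s.2 + k * dy) ∧
      ∀ j : ℕ, 1 ≤ j → j < k → ((s.1 + j * dx, s.2 + j * dy) : Square) ∉ occ

/-- A placement of the pieces: White has a king and at most one bishop and one knight
(`none` once captured), Black has a lone king. -/
structure Position where
  whiteKing : Square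
  bishop : Option Square
  knight : Option Square
  blackKing : Square

/-- The occupied squares. -/
def Position.occ (p : Position) : Set Square :=
  {s | s = p.whiteKing ∨ p.bishop = some s ∨ p.knight = some s ∨ s = p.blackKing}

/-- The black king is attacked by a white piece. -/
def Position.InCheck (p : Position) : Prop :=
  KingStep p.whiteKing p.blackKing ∨
  (∃ b, p.bishop = some b ∧ BishopStep p.occ b p.blackKing) ∨
  (∃ k, p.knight = some k ∧ KnightStep k p.blackKing)

/-- The placement after the black king has gone to `t`, a white bishop or knight standing
on `t` being captured. -/
def Position.afterBlack (p : Position) (t : Square) : Position where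
  whiteKing := p.whiteKing
  bishop := if p.bishop = some t then none else p.bishop
  knight := if p.knight = some t then none else p.knight
  blackKing := t

/-- `q` arises from `p` by a legal move of Black on the `n × n` board. -/
def BlackMove (n : ℕ) (p q : Position) : Prop :=
  ∃ t, OnBoard n t ∧ KingStep p.blackKing t ∧ t ≠ p.whiteKing ∧
    q = p.afterBlack t ∧ ¬ q.InCheck

/-- `q` arises from `p` by a legal move of White on the `n × n` board: to an unoccupied square,
and with the white king not next to the black king if it is the king that moves. -/
def WhiteMove (n : ℕ) (p q : Position) : Prop :=
  ∃ t, OnBoard n t ∧ t ∉ p.occ ∧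
    ((KingStep p.whiteKing t ∧ ¬ KingStep t p.blackKing ∧ q = { p with whiteKing := t }) ∨
     (∃ b, p.bishop = some b ∧ BishopStep p.occ b t ∧ q = { p with bishop := some t }) ∨
     (∃ k, p.knight = some k ∧ KnightStep k t ∧ q = { p with knight := some t }))

/-- With Black to move: Black is checkmated. -/
def IsCheckmate (n : ℕ) (p : Position) : Prop :=
  p.InCheck ∧ ∀ q, ¬ BlackMove n p q

/-- Starting from `p` with Black to move, White can force that a position (with Black to move)
in `T` occurs after at most `m` moves of White. If Black has no legal move
outside `T`, the game has ended and White has failed. -/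
def ForcesWithin (n : ℕ) (T : Position → Prop) : ℕ → Position → Prop
  | 0, p => T p
  | m + 1, p => T p ∨
      ((∃ q, BlackMove n p q) ∧
        ∀ q, BlackMove n p q → ∃ r, WhiteMove n q r ∧ ForcesWithin n T m r)

/-- All pieces on file `x`: the black king on the first rank, the white knight directly above it,
the white king directly above the knight, the bishop three squares above the white king. -/
def edgeConfig (x : ℤ) : Position where
  whiteKing := (x, 2)
  bishop := some (x, 5)
  knight := some (x, 1)
  blackKing := (x, 0)

/-!
The configuration `edgeConfig x` moves along the edge by a strategy that only sees the pieces in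
relation to each other, so it can be played with `x = 0` on an idealised board and then translated.

To shift the box by two files, White walks the knight to `(2, 1)`, where it guards `(0, 0)` and
`(4, 0)` and, together with the bishop on `(0, 5)` and the white king on `(1, 2)`, confines the
black king to the files `1`, `2` and `3`. It remains to bring the white king to `(2, 2)` and the
bishop to `(2, 5)` just when the black king is on `(2, 0)`; the spare moves of the bishop, a rider,
supply the right timing. Until the knight gets there, a black king stepping back to `(-1, 0)` is
met by the bishop check on `(-3, 2)`, which leaves only the return to `(0, 0)`. For `x = n - 2`
the corner `(1, 0)` is a light square, and Black is mated there in five moves.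

These strategies are the tables `shiftPlan` and `matePlan`. White only uses squares in a window
that is on the board for every admissible `n` and `x`, while the black king may use every square
not excluded by an edge of the board that is certain to be there. Boards with further edges only
take moves away from Black; stalemate is ruled out by asking, in each position without check, for
a legal black move inside the window. `Plan.forces_translate` turns the resulting finite check
`Plan.wins` into `ForcesWithin` on every board that is compatible with the window, and
`ForcesWithin.trans` chains the shifts up to the corner.
-/

/-! ### Composing forced wins -/

theorem ForcesWithin.of_target {n : ℕ} {T : Position → Prop} {p : Position} (h : T p) :
    ∀ m, ForcesWithin n T m p
  | 0 => h
  | _ + 1 => Or.inl h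

theorem ForcesWithin.trans {n : ℕ} {S T : Position → Prop} {b : ℕ}
    (h : ∀ p, S p → ForcesWithin n T b p) :
    ∀ {a : ℕ} {p : Position}, ForcesWithin n S a p → ForcesWithin n T (b + a) p := by
  have mono : ∀ (c a : ℕ) (p : Position), ForcesWithin n T c p → ForcesWithin n T (c + a) p := by
    intro c
    induction c with
    | zero => exact fun a p hp => .of_target hp _
    | succ c ih =>
      intro a p hp
      rw [Nat.add_right_comm]
      refine hp.imp id fun hp => ⟨hp.1, fun q hq => ?_⟩
      obtain ⟨r, hr, hw⟩ := hp.2 q hq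
      exact ⟨r, hr, ih a r hw⟩
  intro a
  induction a with
  | zero => exact fun {p} hp => h p hp
  | succ a ih =>
    rintro p (hp | hp)
    · exact mono b (a + 1) p (h p hp)
    · refine Or.inr ⟨hp.1, fun q hq => ?_⟩
      obtain ⟨r, hr, hw⟩ := hp.2 q hq
      exact ⟨r, hr, ih hw⟩

theorem ForcesWithin.mono {n : ℕ} {T : Position → Prop} {a b : ℕ} {p : Position} (hab : a ≤ b)
    (h : ForcesWithin n T a p) : ForcesWithin n T b p := by
  obtain ⟨c, rfl⟩ := Nat.exists_eq_add_of_le' hab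
  exact h.trans fun p hp => .of_target hp c

/-! ### Deciding the rules -/

instance : DecidableEq Position := fun p q =>
  decidable_of_iff (p.whiteKing = q.whiteKing ∧ p.bishop = q.bishop ∧ p.knight = q.knight ∧
    p.blackKing = q.blackKing) (by cases p; cases q; simp)

instance (s t : Square) : Decidable (KingStep s t) :=
  inferInstanceAs (Decidable (_ ∧ _ ∧ _))

instance (s t : Square) : Decidable (KnightStep s t) :=
  inferInstanceAs (Decidable (_ ∨ _))

instance (p : Position) : DecidablePred (· ∈ p.occ) := fun _ =>
  inferInstanceAs (Decidable (_ ∨ _ ∨ _ ∨ _))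

/-- The direction and the length of a bishop's move are determined by its end points. -/
theorem bishopStep_iff {occ : Set Square} {s t : Square} :
    BishopStep occ s t ↔ (t.1 - s.1).natAbs = (t.2 - s.2).natAbs ∧ t.1 ≠ s.1 ∧
      ∀ j < (t.1 - s.1).natAbs, 1 ≤ j →
        ((s.1 + j * (t.1 - s.1).sign, s.2 + j * (t.2 - s.2).sign) : Square) ∉ occ := by
  constructor
  · rintro ⟨dx, dy, hx, hy, k, hk, rfl, h⟩
    have hx' : (s.1 + k * dx - s.1).sign = dx ∧ (s.1 + k * dx - s.1).natAbs = k := by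
      rw [add_sub_cancel_left, Int.sign_mul, Int.natAbs_mul, Int.sign_natCast_of_ne_zero (by omega)]
      rcases hx with rfl | rfl <;> simp
    have hy' : (s.2 + k * dy - s.2).sign = dy ∧ (s.2 + k * dy - s.2).natAbs = k := by
      rw [add_sub_cancel_left, Int.sign_mul, Int.natAbs_mul, Int.sign_natCast_of_ne_zero (by omega)]
      rcases hy with rfl | rfl <;> simp
    refine ⟨hx'.2.trans hy'.2.symm, ?_, ?_⟩
    · rcases hx with rfl | rfl <;> dsimp only <;> omega
    · dsimp only
      rw [hx'.1, hy'.1, hx'.2]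
      exact fun j hj hj1 => h j hj1 hj
  · rintro ⟨h1, h2, h⟩
    have sign_cases : ∀ a : ℤ, a ≠ 0 → a.sign = 1 ∨ a.sign = -1 := fun a ha =>
      (lt_or_gt_of_ne ha).elim (fun h => .inr (Int.sign_eq_neg_one_of_neg h))
        (fun h => .inl (Int.sign_eq_one_of_pos h))
    refine ⟨_, _, sign_cases (t.1 - s.1) (by omega), sign_cases (t.2 - s.2) (by omega),
      (t.1 - s.1).natAbs, by omega, ?_, fun j hj1 hj => h j hj hj1⟩
    have e1 : ((t.1 - s.1).natAbs : ℤ) * (t.1 - s.1).sign = t.1 - s.1 := by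
      rw [mul_comm]; exact Int.sign_mul_natAbs _
    have e2 : ((t.1 - s.1).natAbs : ℤ) * (t.2 - s.2).sign = t.2 - s.2 := by
      rw [h1, mul_comm]; exact Int.sign_mul_natAbs _
    ext
    · simp only [e1]; ring
    · simp only [e2]; ring

instance (occ : Set Square) [DecidablePred (· ∈ occ)] (s t : Square) :
    Decidable (BishopStep occ s t) :=
  have : ∀ u : Square, Decidable (u ∉ occ) := fun u =>
    inferInstanceAs (Decidable (¬ (fun u => u ∈ occ) u))
  decidable_of_iff _ bishopStep_iff.symm

instance decidableExistsSome {α : Type*} (o : Option α) (P : α → Prop) [DecidablePred P] :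
    Decidable (∃ a, o = some a ∧ P a) :=
  match o with
  | none => .isFalse (by simp)
  | some a => decidable_of_iff (P a) (by simp)

instance (p : Position) : Decidable p.InCheck :=
  inferInstanceAs (Decidable (_ ∨ _ ∨ _))

/-! ### Translating positions -/

/-- The placement `p` with every piece moved by the vector `v`. -/
def Position.translate (p : Position) (v : Square) : Position where
  whiteKing := p.whiteKing + v
  bishop := p.bishop.map (· + v)
  knight := p.knight.map (· + v)
  blackKing := p.blackKing + v

theorem kingStep_translate (s t v : Square) : KingStep (s + v) (t + v) ↔ KingStep s t := by
  simp [KingStep]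

theorem knightStep_translate (s t v : Square) : KnightStep (s + v) (t + v) ↔ KnightStep s t := by
  simp [KnightStep]

theorem map_add_right_eq_some {o : Option Square} {t v : Square} :
    o.map (· + v) = some (t + v) ↔ o = some t :=
  (Option.map_injective (add_left_injective v)).eq_iff (b := some t)

theorem mem_occ_translate (p : Position) (s v : Square) :
    s + v ∈ (p.translate v).occ ↔ s ∈ p.occ := by
  simp only [Position.occ, Position.translate, Set.mem_ofPred_eq, add_left_inj,
    map_add_right_eq_some]

theorem bishopStep_translate (p : Position) (s t v : Square) :
    BishopStep (p.translate v).occ (s + v) (t + v) ↔ BishopStep p.occ s t := by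
  have key (a b : ℤ) : (((s + v).1 + a, (s + v).2 + b) : Square) ∈ (p.translate v).occ ↔
      ((s.1 + a, s.2 + b) : Square) ∈ p.occ := by
    rw [← mem_occ_translate p _ v]
    simp [Prod.add_def, add_right_comm]
  simp only [bishopStep_iff, key]
  simp only [Prod.fst_add, Prod.snd_add, add_sub_add_right_eq_sub, ne_eq, add_left_inj]

theorem inCheck_translate (p : Position) (v : Square) : (p.translate v).InCheck ↔ p.InCheck := by
  have hb (b : Square) : BishopStep (p.translate v).occ (b + v) (p.translate v).blackKing ↔
      BishopStep p.occ b p.blackKing := bishopStep_translate p b p.blackKing v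
  unfold Position.InCheck
  refine or_congr (kingStep_translate ..) (or_congr ?_ ?_)
  · cases h : p.bishop <;> simp_all [Position.translate]
  · cases h : p.knight <;> simp [Position.translate, h, knightStep_translate]

theorem afterBlack_translate (p : Position) (t v : Square) :
    (p.translate v).afterBlack (t + v) = (p.afterBlack t).translate v := by
  simp only [Position.afterBlack, Position.translate, map_add_right_eq_some]
  congr 1 <;> split_ifs <;> rfl

/-- Stepping to `t` is legal for the black king, on a board without edges. -/
def Position.BlackLegal (p : Position) (t : Square) : Prop :=
  KingStep p.blackKing t ∧ t ≠ p.whiteKing ∧ ¬ (p.afterBlack t).InCheck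

instance (p : Position) (t : Square) : Decidable (p.BlackLegal t) :=
  inferInstanceAs (Decidable (_ ∧ _ ∧ _))

theorem blackMove_translate_iff {n : ℕ} {p q : Position} {v : Square} :
    BlackMove n (p.translate v) q ↔
      ∃ t, OnBoard n (t + v) ∧ p.BlackLegal t ∧ q = (p.afterBlack t).translate v := by
  constructor
  · rintro ⟨t, ht, hk, hw, rfl, hc⟩
    obtain ⟨t, rfl⟩ : ∃ s, t = s + v := ⟨t - v, (sub_add_cancel t v).symm⟩
    rw [afterBlack_translate] at hc ⊢
    exact ⟨t, ht, ⟨(kingStep_translate ..).1 hk, fun h => hw (h ▸ rfl),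
      fun h => hc ((inCheck_translate ..).2 h)⟩, rfl⟩
  · rintro ⟨t, ht, ⟨hk, hw, hc⟩, rfl⟩
    refine ⟨t + v, ht, (kingStep_translate ..).2 hk, fun h => hw (add_right_cancel h),
      (afterBlack_translate ..).symm, fun h => hc ((inCheck_translate ..).1 h)⟩

/-- A move of White: the piece that moves, and its destination. -/
inductive Reply
  | king (t : Square)
  | bishop (t : Square)
  | knight (t : Square)

/-- The destination of the moving piece. -/
def Reply.dest : Reply → Square
  | king t => t
  | bishop t => t
  | knight t => t

/-- The placement after the move. -/
def Reply.play (q : Position) : Reply → Position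
  | king t => { q with whiteKing := t }
  | bishop t => { q with bishop := some t }
  | knight t => { q with knight := some t }

/-- The move follows the rules, on a board without edges. -/
def Reply.Legal (q : Position) (r : Reply) : Prop :=
  r.dest ∉ q.occ ∧
    match r with
    | king t => KingStep q.whiteKing t ∧ ¬ KingStep t q.blackKing
    | bishop t => ∃ b, q.bishop = some b ∧ BishopStep q.occ b t
    | knight t => ∃ k, q.knight = some k ∧ KnightStep k t

instance (q : Position) (r : Reply) : Decidable (r.Legal q) :=
  match r with
  | .king t => inferInstanceAs (Decidable (¬ (fun u => u ∈ q.occ) t ∧ _ ∧ _))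
  | .bishop t => inferInstanceAs (Decidable (¬ (fun u => u ∈ q.occ) t ∧
      ∃ b, q.bishop = some b ∧ BishopStep q.occ b t))
  | .knight t => inferInstanceAs (Decidable (¬ (fun u => u ∈ q.occ) t ∧
      ∃ k, q.knight = some k ∧ KnightStep k t))

theorem Reply.Legal.whiteMove_translate {n : ℕ} {q : Position} {r : Reply} {v : Square}
    (h : r.Legal q) (hv : OnBoard n (r.dest + v)) :
    WhiteMove n (q.translate v) ((r.play q).translate v) := by
  refine ⟨r.dest + v, hv, mt (mem_occ_translate ..).1 h.1, ?_⟩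
  cases r with
  | king t =>
    exact .inl ⟨(kingStep_translate ..).2 h.2.1, mt (kingStep_translate ..).1 h.2.2, rfl⟩
  | bishop t =>
    obtain ⟨-, b, hb, hs⟩ := h
    exact .inr (.inl ⟨b + v, by simp [Position.translate, hb], (bishopStep_translate ..).2 hs, rfl⟩)
  | knight t =>
    obtain ⟨-, k, hk, hs⟩ := h
    exact .inr (.inr ⟨k + v, by simp [Position.translate, hk], (knightStep_translate ..).2 hs, rfl⟩)

/-! ### Checking a strategy -/

/-- The squares next to `s`. -/
def neighbours (s : Square) : List Square :=
  [(s.1 - 1, s.2 - 1), (s.1 - 1, s.2), (s.1 - 1, s.2 + 1), (s.1, s.2 - 1),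
   (s.1, s.2 + 1), (s.1 + 1, s.2 - 1), (s.1 + 1, s.2), (s.1 + 1, s.2 + 1)]

theorem mem_neighbours {s t : Square} (h : KingStep s t) : t ∈ neighbours s := by
  obtain ⟨a, b⟩ := s
  obtain ⟨c, d⟩ := t
  obtain ⟨hne, h1, h2⟩ := h
  simp only [abs_le, ne_eq, Prod.mk.injEq] at hne h1 h2
  simp only [neighbours, List.mem_cons, Prod.mk.injEq, List.not_mem_nil, or_false]
  omega

/-- What is known about the edges of the board: the squares of `inside` certainly belong to it,
and every square of the board satisfies `allowed`. -/
structure Frame where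
  inside : Square → Bool
  allowed : Square → Bool

/-- The frame fits the `n × n` board, when its origin is put on the square `v`. -/
structure Frame.Fits (F : Frame) (n : ℕ) (v : Square) : Prop where
  onBoard : ∀ t, F.inside t → OnBoard n (t + v)
  allowed : ∀ t, OnBoard n (t + v) → F.allowed t

/-- The steps that the black king might have on a board fitting the frame. -/
def Frame.blackSteps (F : Frame) (p : Position) : List Square :=
  (neighbours p.blackKing).filter fun t => F.allowed t && p.BlackLegal t

/-- Black is mated on every board that fits the frame. -/
def Frame.mated (F : Frame) (p : Position) : Bool :=
  p.InCheck && (F.blackSteps p).isEmpty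

/-- A memoryless strategy of White: answers to positions with White to move. -/
abbrev Plan := List (Position × Reply)

/-- Following the plan, White reaches a position with `goal`, or mate, in at most the given number
of moves, whatever the black king does within the frame. Stalemate is excluded by a check or by a
black move to a square of the board. -/
def Plan.wins (P : Plan) (F : Frame) (goal : Position → Bool) : ℕ → Position → Bool
  | 0, p => goal p || F.mated p
  | m + 1, p => goal p ||
      (decide p.InCheck || (F.blackSteps p).any F.inside) &&
        (F.blackSteps p).all fun t =>
          match P.lookup (p.afterBlack t) with
          | none => false
          | some r => F.inside r.dest && decide (r.Legal (p.afterBlack t)) &&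
              P.wins F goal m (r.play (p.afterBlack t))

theorem Frame.Fits.mem_blackSteps {F : Frame} {n : ℕ} {v : Square} (hF : F.Fits n v)
    {p : Position} {t : Square} (ht : OnBoard n (t + v)) (h : p.BlackLegal t) :
    t ∈ F.blackSteps p := by
  simp [Frame.blackSteps, mem_neighbours h.1, hF.allowed t ht, h]

theorem Frame.Fits.isCheckmate {F : Frame} {n : ℕ} {v : Square} (hF : F.Fits n v)
    {p : Position} (h : F.mated p) : IsCheckmate n (p.translate v) := by
  simp only [Frame.mated, Bool.and_eq_true, decide_eq_true_eq, List.isEmpty_iff] at h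
  refine ⟨(inCheck_translate ..).2 h.1, fun q hq => ?_⟩
  obtain ⟨t, ht, hl, -⟩ := blackMove_translate_iff.1 hq
  simpa [h.2] using hF.mem_blackSteps ht hl

/-- A plan that wins in a frame wins on every board the frame fits. Further edges of that board
only remove black moves; if none remains, Black is in check and hence mated. -/
theorem Plan.forces_translate {P : Plan} {F : Frame} {n : ℕ} {v : Square} (hF : F.Fits n v)
    {goal : Position → Bool} {T : Position → Prop} (hgoal : ∀ p, goal p → T (p.translate v))
    (hmate : ∀ p, IsCheckmate n p → T p) :
    ∀ {m : ℕ} {p : Position}, P.wins F goal m p → ForcesWithin n T m (p.translate v) := by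
  intro m
  induction m with
  | zero =>
    intro p h
    simp only [Plan.wins, Bool.or_eq_true] at h
    exact h.elim (hgoal p) fun h => hmate _ (hF.isCheckmate h)
  | succ m ih =>
    intro p h
    simp only [Plan.wins, Bool.or_eq_true, Bool.and_eq_true, decide_eq_true_eq, List.any_eq_true,
      List.all_eq_true] at h
    obtain h | ⟨hmove, hall⟩ := h
    · exact .inl (hgoal p h)
    by_cases hex : ∃ q, BlackMove n (p.translate v) q
    · refine .inr ⟨hex, fun q hq => ?_⟩
      obtain ⟨t, ht, hl, rfl⟩ := blackMove_translate_iff.1 hq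
      have hr := hall t (hF.mem_blackSteps ht hl)
      split at hr
      · cases hr
      · rename_i r _
        simp only [Bool.and_eq_true, decide_eq_true_eq] at hr
        exact ⟨_, hr.1.2.whiteMove_translate (hF.onBoard _ hr.1.1), ih hr.2⟩
    · refine .inl (hmate _ ⟨?_, fun q hq => hex ⟨q, hq⟩⟩)
      obtain hc | ⟨t, ht, hin⟩ := hmove
      · exact (inCheck_translate ..).2 hc
      · simp only [Frame.blackSteps, List.mem_filter, Bool.and_eq_true, decide_eq_true_eq] at ht
        exact (hex ⟨_, blackMove_translate_iff.2 ⟨t, hF.onBoard t hin, ht.2.2, rfl⟩⟩).elim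

/-! ### The two strategies -/

/-- The placement of the white king, the bishop, the knight and the black king, in this order. -/
def place (K B N k : Square) : Position := ⟨K, some B, some N, k⟩

/-- The frame along the bottom edge, far from the other edges: a window of eight by eight squares
is known to be on the board. -/
def edgeFrame : Frame where
  inside t := -4 ≤ t.1 && t.1 ≤ 3 && 0 ≤ t.2 && t.2 ≤ 7
  allowed t := 0 ≤ t.2

/-- The frame at the bottom right corner, which is the square `(1, 0)`: a window of six by six
squares is known to be on the board. -/
def cornerFrame : Frame where
  inside t := -4 ≤ t.1 && t.1 ≤ 1 && 0 ≤ t.2 && t.2 ≤ 5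
  allowed t := 0 ≤ t.2 && t.1 ≤ 1

/-- White's strategy for moving the configuration from file `0` to file `2`. -/
def shiftPlan : Plan :=
  [(place (0, 2) (0, 5) (0, 1) (-1, 0), .bishop (-3, 2)),
   (place (0, 2) (0, 5) (0, 1) (1, 0), .knight (1, 3)),
   (place (0, 2) (-3, 2) (0, 1) (0, 0), .knight (1, 3)),
   (place (0, 2) (-3, 2) (1, 3) (1, 0), .bishop (0, 5)),
   (place (0, 2) (0, 5) (1, 3) (0, 0), .knight (-1, 2)),
   (place (0, 2) (0, 5) (1, 3) (2, 0), .king (1, 2)),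
   (place (0, 2) (0, 5) (-1, 2) (-1, 0), .bishop (-3, 2)),
   (place (0, 2) (0, 5) (-1, 2) (1, 0), .king (1, 2)),
   (place (1, 2) (0, 5) (-1, 2) (2, 0), .knight (0, 0)),
   (place (1, 2) (0, 5) (0, 0) (1, 0), .knight (2, 1)),
   (place (1, 2) (0, 5) (0, 0) (3, 0), .knight (2, 1)),
   (place (1, 2) (0, 5) (0, 0) (3, 1), .knight (2, 1)),
   (place (1, 2) (0, 5) (1, 3) (1, 0), .knight (2, 1)),
   (place (1, 2) (0, 5) (1, 3) (3, 0), .knight (2, 1)),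
   (place (1, 2) (0, 5) (1, 3) (3, 1), .knight (2, 1)),
   (place (1, 2) (0, 5) (2, 1) (2, 0), .bishop (1, 4)),
   (place (1, 2) (0, 5) (2, 1) (3, 1), .king (1, 1)),
   (place (1, 1) (0, 5) (2, 1) (3, 0), .king (2, 2)),
   (place (1, 2) (0, 5) (2, 1) (2, 0), .bishop (1, 4)),
   (place (1, 2) (0, 5) (2, 1) (2, 0), .bishop (1, 4)),
   (place (1, 2) (0, 5) (2, 1) (3, 0), .king (1, 1)),
   (place (1, 1) (0, 5) (2, 1) (3, 1), .bishop (1, 4)),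
   (place (1, 2) (1, 4) (2, 1) (1, 0), .bishop (2, 5)),
   (place (1, 2) (1, 4) (2, 1) (3, 0), .king (2, 2)),
   (place (1, 2) (1, 4) (2, 1) (3, 1), .king (1, 1)),
   (place (2, 2) (0, 5) (2, 1) (2, 0), .bishop (2, 3)),
   (place (1, 1) (1, 4) (2, 1) (3, 0), .king (2, 2)),
   (place (2, 2) (2, 3) (2, 1) (1, 0), .bishop (3, 4)),
   (place (2, 2) (2, 3) (2, 1) (3, 0), .bishop (1, 4)),
   (place (1, 2) (2, 5) (2, 1) (2, 0), .king (2, 2)),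
   (place (2, 2) (1, 4) (2, 1) (2, 0), .bishop (2, 5)),
   (place (2, 2) (3, 4) (2, 1) (2, 0), .bishop (2, 5))]

/-- White's strategy for mating in the corner `(1, 0)`. -/
def matePlan : Plan :=
  [(place (0, 2) (0, 5) (0, 1) (-1, 0), .bishop (-3, 2)),
   (place (0, 2) (0, 5) (0, 1) (1, 0), .king (-1, 1)),
   (place (-1, 1) (0, 5) (0, 1) (1, 1), .bishop (-1, 4)),
   (place (0, 2) (-3, 2) (0, 1) (0, 0), .bishop (-4, 3)),
   (place (-1, 1) (-1, 4) (0, 1) (1, 0), .knight (-2, 2)),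
   (place (0, 2) (-4, 3) (0, 1) (1, 0), .knight (-1, 3)),
   (place (-1, 1) (-1, 4) (-2, 2) (1, 1), .knight (-1, 0)),
   (place (0, 2) (-4, 3) (-1, 3) (0, 0), .knight (1, 2)),
   (place (-1, 1) (-1, 4) (-1, 0) (1, 0), .bishop (-2, 3)),
   (place (0, 2) (-4, 3) (1, 2) (1, 0), .bishop (-3, 4))]

theorem shiftPlan_wins : shiftPlan.wins edgeFrame (· = edgeConfig 2) 12 (edgeConfig 0) := by
  decide +kernel

theorem matePlan_wins : matePlan.wins cornerFrame (fun _ => false) 5 (edgeConfig 0) := by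
  decide +kernel

theorem edgeConfig_translate (a x : ℤ) :
    (edgeConfig a).translate (x, 0) = edgeConfig (x + a) := by
  simp [Position.translate, edgeConfig, add_comm]

theorem forcesWithin_shift {n x : ℕ} (hx : 4 ≤ x) (hn : x + 4 ≤ n) :
    ForcesWithin n (fun p => p = edgeConfig ((x : ℤ) + 2) ∨ IsCheckmate n p) 12
      (edgeConfig (x : ℤ)) := by
  have hF : edgeFrame.Fits n ((x : ℤ), 0) := by
    constructor <;> intro t <;> simp [edgeFrame, OnBoard] <;> omega
  have := Plan.forces_translate (T := fun p => p = edgeConfig ((x : ℤ) + 2) ∨ IsCheckmate n p) hF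
    (fun p hp => .inl (by rw [of_decide_eq_true hp, edgeConfig_translate]))
    (fun p => Or.inr) shiftPlan_wins
  rwa [edgeConfig_translate, add_zero] at this

theorem forcesWithin_mate {n x : ℕ} (hx : 4 ≤ x) (hn : x + 2 = n) :
    ForcesWithin n (IsCheckmate n) 5 (edgeConfig (x : ℤ)) := by
  have hF : cornerFrame.Fits n ((x : ℤ), 0) := by
    constructor <;> intro t <;> simp [cornerFrame, OnBoard] <;> omega
  have := Plan.forces_translate (T := IsCheckmate n) hF (fun p hp => by simp at hp)
    (fun p => id) matePlan_wins
  rwa [edgeConfig_translate, add_zero] at this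

/-- With `k` shifts to go until the corner, mate takes at most `12 * k + 5` moves. -/
theorem forcesWithin_mate_of_shifts {n : ℕ} :
    ∀ {k x : ℕ}, 4 ≤ x → x + 2 + 2 * k = n →
      ForcesWithin n (IsCheckmate n) (12 * k + 5) (edgeConfig (x : ℤ)) := by
  intro k
  induction k with
  | zero => exact fun hx hn => forcesWithin_mate hx (by omega)
  | succ k ih =>
    intro x hx hn
    rw [show 12 * (k + 1) + 5 = 12 * k + 5 + 12 by ring]
    refine (forcesWithin_shift hx (by omega)).trans ?_
    rintro p (rfl | hp)
    · exact_mod_cast ih (x := x + 2) (by omega) (by omega)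
    · exact .of_target hp _

theorem mainTheorem2 :
    (∀ n x : ℕ, Even n → Even x → 4 ≤ x → x + 4 ≤ n →
      ForcesWithin n (fun p => p = edgeConfig ((x : ℤ) + 2) ∨ IsCheckmate n p) 12
        (edgeConfig (x : ℤ))) ∧
    (∃ C : ℕ, ∀ n x : ℕ, Even n → Even x → 4 ≤ x → x + 2 ≤ n →
      ForcesWithin n (IsCheckmate n) (C * n) (edgeConfig (x : ℤ))) := by
  refine ⟨fun n x _ _ hx hn => forcesWithin_shift hx hn, 6, ?_⟩
  rintro n x ⟨a, ha⟩ ⟨b, hb⟩ hx hn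
  exact (forcesWithin_mate_of_shifts (k := a - b - 1) hx (by omega)).mono (by omega)
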